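/- Let $X$ be a normal topological space and let $E\subseteq X$ be an ambiguous set, i.e. $E$ is both an $F_\sigma$-set and a $G_\delta$-set in $X$. Suppose that $E$, with the subspace topology, is nonempty, metrizable, arcwise connected (any two points of $E$ are joined by a continuous path $[0,1]\to E$) and locally arcwise connected (for every $x\in E$ and every neighbourhood $U$ of $x$ in $E$ there is a neighbourhood $V$ of $x$ in $E$ such that every $y\in V$ can be joined to $x$ by a continuous path in $U$). Suppose moreover that at least one of the following holds: (i) $E$ is separable; (ii) $X$ is collectionwise normal, i.e. $X$ is a $T_1$-space and for every discrete family $(F_i)_{i\in I}$ of closed subsets of $X$ there is a discrete family $(G_i)_{i\in I}$ of open subsets of $X$ with $F_i\subseteq G_i$ for all $i\in I$ (a family is discrete if every point of $X$ has a neighbourhood meeting at most one of its members). Then $E$ is a $B_1$-retract of $X$: there is a map $r:X\to E$ with $r(x)=x$ for all $x\in E$ that is the pointwise limit of a sequence of continuous maps $X\to E$. In fact, for every point $x^*\in E$ the map $$r(x)=\begin{cases}x,& x\in E,\\ x^*,& x\in X\setminus E,\end{cases}$$ is such a map. -/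

import Mathlib

open Set Filter Topology

universe u v

/-- `A` is an `F_σ`-set: a countable union of closed sets. -/
def IsFSigmaSet {X : Type u} [TopologicalSpace X] (A : Set X) : Prop :=
  ∃ F : ℕ → Set X, (∀ n, IsClosed (F n)) ∧ A = ⋃ n, F n

/-- `A` is ambiguous: simultaneously `F_σ` and `G_δ`. -/
def IsAmbiguousSet {X : Type u} [TopologicalSpace X] (A : Set X) : Prop :=
  IsFSigmaSet A ∧ IsGδ A

/-- `f` is a Baire-one function: a pointwise limit of a sequence of continuous functions
(with the same domain and the same range space). -/
def IsBaireOne {X : Type u} {Y : Type v} [TopologicalSpace X] [TopologicalSpace Y]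
    (f : X → Y) : Prop :=
  ∃ g : ℕ → X → Y, (∀ n, Continuous (g n)) ∧
    ∀ x, Tendsto (fun n => g n x) atTop (𝓝 (f x))

/-- `r : X → E` is a `B_1`-retraction of `X` onto `E`. -/
def IsB1Retraction {X : Type u} [TopologicalSpace X] (E : Set X) (r : X → E) : Prop :=
  IsBaireOne r ∧ ∀ x : E, r x = x

/-- `E` is a `B_1`-retract of `X`. -/
def IsB1Retract {X : Type u} [TopologicalSpace X] (E : Set X) : Prop :=
  ∃ r : X → E, IsB1Retraction E r

/-- An indexed family of sets is discrete if every point has a neighbourhood that meets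
at most one member of the family. -/
def IsDiscreteFamily {X : Type u} [TopologicalSpace X] {ι : Type v} (A : ι → Set X) : Prop :=
  ∀ x : X, ∃ U ∈ 𝓝 x, {i | (A i ∩ U).Nonempty}.Subsingleton

/-- `X` is collectionwise normal: it is `T_1` and every discrete family of closed sets expands to
a discrete family of open sets. Index types in the universe of `X` suffice, since the nonempty
members of a discrete family are pairwise disjoint, and empty members expand to `∅`. -/
structure IsCollectionwiseNormal (X : Type u) [TopologicalSpace X] : Prop where
  t1 : T1Space X
  expand : ∀ (ι : Type u) (F : ι → Set X), (∀ i, IsClosed (F i)) → IsDiscreteFamily F →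
    ∃ G : ι → Set X, (∀ i, IsOpen (G i)) ∧ IsDiscreteFamily G ∧ ∀ i, F i ⊆ G i

open Classical in
/-- The map `X → E` that is the identity on `E` and sends `X \ E` to the point `c`. -/
noncomputable def collapseTo {X : Type u} (E : Set X) (c : E) (x : X) : E :=
  if h : x ∈ E then ⟨x, h⟩ else c

/-! Write r for the collapse map. For each k it is approximated by a map p_k whose value at x is
joined to r(x) inside the 2^-k-ball about p_k(x), and which is locally constant on each set of an
increasing closed cover (A k n)_n of X. On E this comes from covering E by path components of balls;
ambiguity of E makes the pieces inside and outside E closed in X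
(`exists_locallyConstantOn_approximation`). For fixed n, start from a constant map and correct it
successively to equal p_k near the intersection of the A j n, j ≤ k. There the fibres of (p_k,
p_{k+1}) form a discrete closed family, which separability or collectionwise normality expands to
open sets; on each, an Urysohn function slides the value along a path
(`exists_continuous_refinement`). The moves are summable in k, so the diagonal maps converge to r.
-/

/-- `p` is locally constant on the subspace `A`. -/
def IsLocallyConstantOn {X : Type u} [TopologicalSpace X] {κ : Type v} (p : X → κ)
    (A : Set X) : Prop :=
  ∀ x ∈ A, ∀ᶠ y in 𝓝[A] x, p y = p x

/-- The fibres of `q` on `A` expand to a discrete family of open sets. -/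
def HasDiscreteExpansion {X : Type u} [TopologicalSpace X] {κ : Type v} (q : X → κ)
    (A : Set X) : Prop :=
  ∃ G : κ → Set X, (∀ i, IsOpen (G i)) ∧ IsDiscreteFamily G ∧ ∀ x ∈ A, x ∈ G (q x)

/-! ### Locally constant maps and discrete expansions of their fibres. -/

section LocallyConstant

variable {X : Type*} [TopologicalSpace X] {κ : Type*} {κ' : Type*}

theorem IsLocallyConstantOn.mono {p : X → κ} {A B : Set X} (h : IsLocallyConstantOn p A)
    (hBA : B ⊆ A) : IsLocallyConstantOn p B :=
  fun x hx => (h x (hBA hx)).filter_mono (nhdsWithin_mono x hBA)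

theorem IsLocallyConstantOn.prodMk {p : X → κ} {q : X → κ'} {A : Set X}
    (hp : IsLocallyConstantOn p A) (hq : IsLocallyConstantOn q A) :
    IsLocallyConstantOn (fun x => (p x, q x)) A := fun x hx => by
  filter_upwards [hp x hx, hq x hx] with y h₁ h₂
  rw [h₁, h₂]

theorem IsLocallyConstantOn.union {p : X → κ} {A B : Set X} (hA : IsClosed A) (hB : IsClosed B)
    (hAB : Disjoint A B) (hpA : IsLocallyConstantOn p A) (hpB : IsLocallyConstantOn p B) :
    IsLocallyConstantOn p (A ∪ B) := by
  rintro x (hx | hx)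
  · have hB' : ∀ᶠ y in 𝓝 x, y ∉ B := hB.isOpen_compl.mem_nhds (disjoint_left.1 hAB hx)
    have h := eventually_nhdsWithin_iff.1 (hpA x hx)
    rw [eventually_nhdsWithin_iff]
    filter_upwards [hB', h] with y h₁ h₂ h₃
    exact h₂ (h₃.resolve_right h₁)
  · have hA' : ∀ᶠ y in 𝓝 x, y ∉ A := hA.isOpen_compl.mem_nhds (disjoint_right.1 hAB hx)
    have h := eventually_nhdsWithin_iff.1 (hpB x hx)
    rw [eventually_nhdsWithin_iff]
    filter_upwards [hA', h] with y h₁ h₂ h₃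
    exact h₂ (h₃.resolve_left h₁)

theorem IsLocallyConstantOn.isClosed_fiber {q : X → κ} {A : Set X} (hA : IsClosed A)
    (hq : IsLocallyConstantOn q A) (i : κ) : IsClosed (A ∩ q ⁻¹' {i}) := by
  rw [← isOpen_compl_iff, isOpen_iff_mem_nhds]
  intro x hx
  by_cases hxA : x ∈ A
  · have hxi : q x ≠ i := fun h => hx ⟨hxA, h⟩
    filter_upwards [eventually_nhdsWithin_iff.1 (hq x hxA)] with y hy hyA
    exact hxi ((hy hyA.1).symm.trans hyA.2)
  · filter_upwards [hA.isOpen_compl.mem_nhds hxA] with y hy hyA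
    exact hy hyA.1

theorem IsLocallyConstantOn.isDiscreteFamily {q : X → κ} {A : Set X} (hA : IsClosed A)
    (hq : IsLocallyConstantOn q A) : IsDiscreteFamily fun i => A ∩ q ⁻¹' {i} := by
  intro x
  by_cases hxA : x ∈ A
  · refine ⟨_, eventually_nhdsWithin_iff.1 (hq x hxA), ?_⟩
    rintro i ⟨y, ⟨hyA, hyi⟩, hy⟩ j ⟨z, ⟨hzA, hzj⟩, hz⟩
    exact (hyi.symm.trans (hy hyA)).trans ((hz hzA).symm.trans hzj)
  · refine ⟨_, hA.isOpen_compl.mem_nhds hxA, ?_⟩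
    rintro i ⟨y, ⟨hyA, -⟩, hy⟩
    exact (hy hyA).elim

end LocallyConstant

theorem IsLocallyConstantOn.hasDiscreteExpansion_of_collectionwiseNormal {X κ : Type u}
    [TopologicalSpace X] (hX : IsCollectionwiseNormal X) {q : X → κ} {A : Set X}
    (hA : IsClosed A) (hq : IsLocallyConstantOn q A) : HasDiscreteExpansion q A := by
  obtain ⟨G, hG, hGd, hFG⟩ := hX.expand κ (fun i => A ∩ q ⁻¹' {i}) (hq.isClosed_fiber hA)
    (hq.isDiscreteFamily hA)
  exact ⟨G, hG, hGd, fun x hx => hFG (q x) ⟨hx, rfl⟩⟩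

/-- Code the values by integers and extend the code by Tietze; preimages of 1/4-balls about distinct
integers stay apart. -/
theorem IsLocallyConstantOn.hasDiscreteExpansion_of_countable {X : Type u} {κ : Type v}
    [TopologicalSpace X] [NormalSpace X] {q : X → κ} {A : Set X} {S : Set κ}
    (hS : S.Countable) (hqS : ∀ x, q x ∈ S) (hA : IsClosed A) (hq : IsLocallyConstantOn q A) :
    HasDiscreteExpansion q A := by
  obtain ⟨e, he⟩ := countable_iff_exists_injOn.1 hS
  have hc : Continuous fun x : A => (e (q x) : ℝ) := by
    rw [continuous_iff_continuousAt]
    intro x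
    have h := hq x x.2
    rw [nhdsWithin_eq_map_subtype_coe x.2, eventually_map] at h
    refine continuousAt_const.congr (f := fun _ => (e (q x) : ℝ)) ?_
    filter_upwards [h] with y hy
    rw [hy]
  obtain ⟨f, hf⟩ := ContinuousMap.exists_restrict_eq hA ⟨_, hc⟩
  have hfA : ∀ x ∈ A, f x = e (q x) := fun x hx => congrArg (fun F => F ⟨x, hx⟩) hf
  refine ⟨fun i => {x | i ∈ S ∧ |f x - e i| < 1 / 4}, fun i => ?_, fun x => ?_, fun x hx => ?_⟩
  · by_cases hi : i ∈ S
    · simp only [hi, true_and]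
      exact isOpen_lt (by fun_prop) continuous_const
    · simp [hi]
  · refine ⟨{y | |f y - f x| < 1 / 4}, ?_, ?_⟩
    · exact (isOpen_lt (by fun_prop) continuous_const).mem_nhds (by simp)
    · rintro i ⟨y, ⟨hi, hyi⟩, hy⟩ j ⟨z, ⟨hj, hzj⟩, hz⟩
      apply he hi hj
      simp only [mem_ofPred_eq, abs_lt] at hyi hy hzj hz
      have h₁ : (e i : ℝ) < e j + 1 := by linarith
      have h₂ : (e j : ℝ) < e i + 1 := by linarith
      norm_cast at h₁ h₂
      omega
  · exact ⟨hqS x, by simp [hfA x hx]⟩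

/-! ### Correcting a continuous map along paths. -/

section Modification

variable {X : Type*} [TopologicalSpace X] {Y : Type*} [TopologicalSpace Y]

theorem exists_bump [NormalSpace X] {F O : Set X} (hF : IsClosed F) (hO : IsOpen O)
    (hFO : F ⊆ O) : ∃ φ : C(X, unitInterval), (∀ x ∈ F, ∀ᶠ y in 𝓝 x, φ y = 1) ∧
      ∀ x, x ∉ O → ∀ᶠ y in 𝓝 x, φ y = 0 := by
  -- Two shrinkings make the bump constant near the points of `F` and off `O`, not merely at them.
  obtain ⟨V, hV, hFV, hVO⟩ := normal_exists_closure_subset hF hO hFO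
  obtain ⟨W, hW, hVW, hWO⟩ := normal_exists_closure_subset isClosed_closure hO hVO
  obtain ⟨f, hf0, hf1, hf⟩ := exists_continuous_zero_one_of_isClosed hW.isClosed_compl
    isClosed_closure (disjoint_left.2 fun x (hx : x ∉ W) hx' => hx (hVW hx'))
  refine ⟨⟨fun x => ⟨f x, hf x⟩, by fun_prop⟩, fun x hx => ?_, fun x hx => ?_⟩
  · filter_upwards [hV.mem_nhds (hFV hx)] with y hy
    exact Subtype.ext (hf1 (subset_closure hy))
  · filter_upwards [isClosed_closure.isOpen_compl.mem_nhds fun h => hx (hWO h)] with y hy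
    exact Subtype.ext (hf0 fun h => hy (subset_closure h))

theorem exists_continuous_modification_along_path [NormalSpace X] {g : X → Y}
    (hg : Continuous g) {F G : Set X} (hF : IsClosed F) (hG : IsOpen G) (hFG : F ⊆ G) {a b : Y}
    (hga : ∀ x ∈ F, ∀ᶠ y in 𝓝 x, g y = a) (γ : Path a b) {S : Y → Y → Prop}
    (hS : ∀ y, S y y) (hγ : ∀ t, S a (γ t)) :
    ∃ h : X → Y, Continuous h ∧ (∀ x, x ∉ G → h x = g x) ∧
      (∀ x ∈ F, ∀ᶠ y in 𝓝 x, h y = b) ∧ ∀ x, S (g x) (h x) := by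
  classical
  -- On this set `g` is the start of the path, so the pasted map joins `g` continuously at its edge.
  set O : Set X := G ∩ interior {x | g x = a} with hOdef
  have hO : IsOpen O := hG.inter isOpen_interior
  have hga' : ∀ x ∈ O, g x = a := fun x hx =>
    interior_subset (s := {x | g x = a}) hx.2
  have hFO : F ⊆ O := fun x hx => ⟨hFG hx, mem_interior_iff_mem_nhds.2 (hga x hx)⟩
  obtain ⟨φ, hφ1, hφ0⟩ := exists_bump hF hO hFO
  refine ⟨fun x => if x ∈ O then γ (φ x) else g x, ?_, ?_, ?_, ?_⟩
  · rw [continuous_iff_continuousAt]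
    intro x
    by_cases hx : x ∈ O
    · refine ContinuousAt.congr (f := fun x => γ (φ x)) (by fun_prop) ?_
      filter_upwards [hO.mem_nhds hx] with y hy
      rw [if_pos hy]
    · refine hg.continuousAt.congr ?_
      filter_upwards [hφ0 x hx] with y hy
      split_ifs with hyO
      · rw [hy, γ.source, hga' y hyO]
      · rfl
  · intro x hx
    exact if_neg fun h => hx h.1
  · intro x hx
    filter_upwards [hφ1 x hx, hO.mem_nhds (hFO hx)] with y hy hyO
    rw [if_pos hyO, hy, γ.target]
  · intro x
    dsimp only
    split_ifs with hx
    · rw [hga' x hx]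
      exact hγ _
    · exact hS _

/-- By discreteness, near any point at most one of the modifications is active. -/
theorem exists_continuous_glue_of_isDiscreteFamily {κ : Type*} {G : κ → Set X}
    (hG : IsDiscreteFamily G) {g : X → Y} (hg : Continuous g) {h : κ → X → Y}
    (hh : ∀ i, Continuous (h i)) (hhg : ∀ i x, x ∉ G i → h i x = g x) :
    ∃ g' : X → Y, Continuous g' ∧ (∀ i, ∀ x ∈ G i, g' x = h i x) ∧
      ∀ x, (∀ i, x ∉ G i) → g' x = g x := by
  classical
  have huniq : ∀ x i j, x ∈ G i → x ∈ G j → i = j := fun x i j hi hj => by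
    obtain ⟨U, hU, hUs⟩ := hG x
    exact hUs ⟨x, hi, mem_of_mem_nhds hU⟩ ⟨x, hj, mem_of_mem_nhds hU⟩
  let g' : X → Y := fun x => if hx : ∃ i, x ∈ G i then h hx.choose x else g x
  have h₁ : ∀ i, ∀ x ∈ G i, g' x = h i x := fun i x hi => by
    have hx : ∃ i, x ∈ G i := ⟨i, hi⟩
    simp only [g', dif_pos hx]
    rw [huniq x _ i hx.choose_spec hi]
  have h₂ : ∀ x, (∀ i, x ∉ G i) → g' x = g x := fun x hx =>
    dif_neg fun ⟨i, hi⟩ => hx i hi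
  refine ⟨g', ?_, h₁, h₂⟩
  rw [continuous_iff_continuousAt]
  intro x
  obtain ⟨U, hU, hUs⟩ := hG x
  by_cases hi : ∃ i, (G i ∩ U).Nonempty
  · obtain ⟨i, hi⟩ := hi
    refine (hh i).continuousAt.congr ?_
    filter_upwards [hU] with y hy
    by_cases hyi : y ∈ G i
    · exact (h₁ i y hyi).symm
    · rw [hhg i y hyi, h₂]
      intro j hj
      exact hyi (hUs hi ⟨y, hj, hy⟩ ▸ hj)
  · refine hg.continuousAt.congr ?_
    filter_upwards [hU] with y hy
    exact (h₂ y fun j hj => hi ⟨j, y, hj, hy⟩).symm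

theorem exists_continuous_refinement [NormalSpace X] {g : X → Y} (hg : Continuous g)
    {A : Set X} (hA : IsClosed A) {p p' : X → Y}
    (hpp' : IsLocallyConstantOn (fun x => (p x, p' x)) A)
    (hex : HasDiscreteExpansion (fun x => (p x, p' x)) A)
    (hgp : ∀ x ∈ A, ∀ᶠ y in 𝓝 x, g y = p x) {S : Y → Y → Prop} (hS : ∀ y, S y y)
    (hpath : ∀ x ∈ A, ∃ γ : Path (p x) (p' x), ∀ t, S (p x) (γ t)) :
    ∃ g' : X → Y, Continuous g' ∧ (∀ x ∈ A, ∀ᶠ y in 𝓝 x, g' y = p' x) ∧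
      ∀ x, S (g x) (g' x) := by
  obtain ⟨G, hGo, hGd, hAG⟩ := hex
  have key : ∀ i : Y × Y, ∃ h : X → Y, Continuous h ∧ (∀ x, x ∉ G i → h x = g x) ∧
      (∀ x ∈ A ∩ (fun x => (p x, p' x)) ⁻¹' {i}, ∀ᶠ y in 𝓝 x, h y = i.2) ∧
      ∀ x, S (g x) (h x) := by
    intro i
    rcases (A ∩ (fun x => (p x, p' x)) ⁻¹' {i}).eq_empty_or_nonempty with he | ⟨x, hxA, hxi⟩
    · exact ⟨g, hg, fun _ _ => rfl, by simp [he], fun x => hS _⟩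
    · obtain ⟨γ, hγ⟩ := hpath x hxA
      obtain rfl : (p x, p' x) = i := hxi
      refine exists_continuous_modification_along_path hg (hpp'.isClosed_fiber hA _) (hGo _)
        ?_ ?_ γ hS hγ
      · rintro y ⟨hyA, hyi⟩
        have : y ∈ G (p y, p' y) := hAG y hyA
        rwa [show (p y, p' y) = (p x, p' x) from hyi] at this
      · rintro y ⟨hyA, hyi⟩
        have := hgp y hyA
        rwa [show p y = p x from congrArg Prod.fst hyi] at this
  choose h hhc hhg hhp hhS using key
  obtain ⟨g', hg'c, hg'h, hg'g⟩ := exists_continuous_glue_of_isDiscreteFamily hGd hg hhc hhg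
  refine ⟨g', hg'c, fun x hx => ?_, fun x => ?_⟩
  · filter_upwards [(hGo _).mem_nhds (hAG x hx), hhp (p x, p' x) x ⟨hx, rfl⟩] with y h₁ h₂
    rw [hg'h _ y h₁, h₂]
  · by_cases hx : ∃ i, x ∈ G i
    · obtain ⟨i, hi⟩ := hx
      rw [hg'h i x hi]
      exact hhS i x
    · rw [hg'g x fun i hi => hx ⟨i, hi⟩]
      exact hS _

end Modification

/-- Go from a to c, then back to b: the second leg stays within 2ε' of c, and c is within ε of a. -/
theorem exists_path_dist_le_of_joinedIn_ball {Y : Type*} [PseudoMetricSpace Y] {a b c : Y}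
    {ε ε' : ℝ} (ha : JoinedIn (Metric.ball a ε) a c) (hb : JoinedIn (Metric.ball b ε') b c) :
    ∃ γ : Path a b, ∀ t, dist a (γ t) ≤ ε + 2 * ε' := by
  have hac := ha.target_mem
  have hbc := hb.target_mem
  have hε' : 0 < ε' := dist_nonneg.trans_lt hbc
  rw [Metric.mem_ball] at hac hbc
  have h : JoinedIn (Metric.closedBall a (ε + 2 * ε')) a b := by
    refine (ha.mono fun z hz => ?_).trans (hb.mono fun z hz => ?_).symm
    · rw [Metric.mem_ball] at hz
      rw [Metric.mem_closedBall]
      linarith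
    · rw [Metric.mem_ball] at hz
      rw [Metric.mem_closedBall]
      have h₁ := dist_triangle z b c
      have h₂ := dist_triangle z c a
      have h₃ := dist_comm b c
      linarith
  refine ⟨h.somePath, fun t => ?_⟩
  rw [dist_comm]
  exact h.somePath_mem t

/-! ### Diagonal limit of successive corrections. -/

/-- A map that is approximated, with respect to short paths, by maps with locally constant
restrictions to closed sets whose fibres expand discretely, is Baire-one. -/
theorem isBaireOne_of_locallyConstant_approximation {X : Type u} {Y : Type v}
    [TopologicalSpace X] [NormalSpace X] [PseudoMetricSpace Y] [PathConnectedSpace Y]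
    {r : X → Y} (p : ℕ → X → Y) (A : ℕ → ℕ → Set X) (c : Y) (hp0 : ∀ x, p 0 x = c)
    (hA : ∀ k n, IsClosed (A k n)) (hAmono : ∀ k, Monotone (A k))
    (hAcover : ∀ k x, ∃ n, x ∈ A k n)
    (hpA : ∀ k n, IsLocallyConstantOn (p k) (A k n))
    (hex : ∀ k (B : Set X), IsClosed B → IsLocallyConstantOn (fun x => (p k x, p (k + 1) x)) B →
      HasDiscreteExpansion (fun x => (p k x, p (k + 1) x)) B)
    (hpr : ∀ k x, k ≠ 0 → JoinedIn (Metric.ball (p k x) ((1 / 2) ^ k)) (p k x) (r x)) :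
    IsBaireOne r := by
  let B : ℕ → ℕ → Set X := fun n k => ⋂ j ∈ Iic k, A j n
  have hBclosed : ∀ n k, IsClosed (B n k) := fun n k =>
    isClosed_biInter fun j _ => hA j n
  have hBA : ∀ n k j, j ≤ k → B n k ⊆ A j n := fun n k j hj => biInter_subset_of_mem hj
  have hBanti : ∀ n k, B n (k + 1) ⊆ B n k := fun n k =>
    biInter_subset_biInter_left (Iic_subset_Iic.2 k.le_succ)
  -- The first move, away from `c`, follows an arbitrary path, so it is exempt from the bound.
  let S : ℕ → Y → Y → Prop := fun k a b => k ≠ 0 → dist a b ≤ 2 * (1 / 2) ^ k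
  let Inv : ℕ → ℕ → (X → Y) → Prop := fun n k g =>
    Continuous g ∧ ∀ x ∈ B n k, ∀ᶠ y in 𝓝 x, g y = p k x
  have step : ∀ n k g, ∃ g', Inv n k g → Inv n (k + 1) g' ∧ ∀ x, S k (g x) (g' x) := by
    intro n k g
    by_cases hinv : Inv n k g
    · have hlc : IsLocallyConstantOn (fun x => (p k x, p (k + 1) x)) (B n (k + 1)) :=
        ((hpA k n).mono (hBA n (k + 1) k k.le_succ)).prodMk
          ((hpA (k + 1) n).mono (hBA n (k + 1) (k + 1) le_rfl))
      obtain ⟨g', h₁, h₂, h₃⟩ := exists_continuous_refinement (S := S k) hinv.1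
        (hBclosed n (k + 1)) hlc (hex k _ (hBclosed n (k + 1)) hlc)
        (fun x hx => hinv.2 x (hBanti n k hx)) (fun y _ => by rw [dist_self]; positivity) (by
          intro x _
          rcases eq_or_ne k 0 with rfl | hk
          · exact ⟨PathConnectedSpace.somePath _ _, fun t h => (h rfl).elim⟩
          · obtain ⟨γ, hγ⟩ := exists_path_dist_le_of_joinedIn_ball (hpr k x hk)
              (hpr (k + 1) x k.succ_ne_zero)
            refine ⟨γ, fun t _ => (hγ t).trans (le_of_eq ?_)⟩
            rw [pow_succ]
            ring)
      exact ⟨g', fun _ => ⟨⟨h₁, h₂⟩, h₃⟩⟩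
    · exact ⟨g, fun h => (hinv h).elim⟩
  choose next hnext using step
  let g : ℕ → ℕ → X → Y := fun n k => Nat.rec (fun _ => c) (fun k g => next n k g) k
  have hInv : ∀ n k, Inv n k (g n k) := by
    intro n k
    induction k with
    | zero => exact ⟨continuous_const, fun x _ => Eventually.of_forall fun y => (hp0 x).symm⟩
    | succ k ih => exact (hnext n k (g n k) ih).1
  have hS : ∀ n k x, k ≠ 0 → dist (g n k x) (g n (k + 1) x) ≤ 2 * (1 / 2) ^ k := fun n k =>
    (hnext n k (g n k) (hInv n k)).2
  refine ⟨fun n => g n n, fun n => (hInv n n).1, fun x => ?_⟩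
  -- Closed form of the geometric sum of the moves from stage `K` on.
  have hdist : ∀ n K m x, K ≠ 0 →
      dist (g n K x) (g n (K + m) x) ≤ 4 * ((1 / 2) ^ K - (1 / 2) ^ (K + m)) := by
    intro n K m x hK
    induction m with
    | zero => simp
    | succ m ih =>
      have h₁ := hS n (K + m) x (by omega)
      have h₂ := dist_triangle (g n K x) (g n (K + m) x) (g n (K + m + 1) x)
      rw [← add_assoc, pow_succ (1 / 2 : ℝ) (K + m)]
      linarith
  rw [Metric.tendsto_atTop]
  intro ε hε
  -- Later moves cost four units of 2^-(K+1), and passing from `p (K + 1) x` to `r x` one more.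
  obtain ⟨K, hK⟩ := exists_pow_lt_of_lt_one (show 0 < ε / 5 by positivity)
    (show (1 / 2 : ℝ) < 1 by norm_num)
  have hK' : (1 / 2 : ℝ) ^ (K + 1) < ε / 5 :=
    (pow_le_pow_of_le_one (by norm_num) (by norm_num) K.le_succ).trans_lt hK
  have hB : ∀ᶠ n in atTop, x ∈ B n (K + 1) := by
    simp only [B, mem_iInter]
    rw [eventually_all_finite (finite_Iic (K + 1))]
    intro j _
    obtain ⟨n, hn⟩ := hAcover j x
    filter_upwards [eventually_ge_atTop n] with m hm
    exact hAmono j hm hn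
  obtain ⟨N, hN⟩ := eventually_atTop.1 (hB.and (eventually_ge_atTop (K + 1)))
  refine ⟨N, fun n hn => ?_⟩
  obtain ⟨hxB, hKn⟩ := hN n hn
  obtain ⟨m, rfl⟩ := Nat.exists_eq_add_of_le hKn
  have h₁ := hdist (K + 1 + m) (K + 1) m x K.succ_ne_zero
  have h₂ : g (K + 1 + m) (K + 1) x = p (K + 1) x :=
    ((hInv (K + 1 + m) (K + 1)).2 x hxB).self_of_nhds
  have h₃ := (hpr (K + 1) x K.succ_ne_zero).target_mem
  rw [Metric.mem_ball] at h₃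
  rw [h₂] at h₁
  have h₄ := dist_triangle (g (K + 1 + m) (K + 1 + m) x) (p (K + 1) x) (r x)
  rw [dist_comm _ (p (K + 1) x), dist_comm (p (K + 1) x) (r x)] at h₄
  dsimp only
  have h₅ : (0 : ℝ) < (1 / 2) ^ (K + 1 + m) := by positivity
  linarith

/-! ### Locally constant approximation of the collapse map. -/

/-- Every open cover `V` of a metric space indexed by a well-ordered set gives rise to a selection
of indices that is locally constant on the members of a closed cover of the space. -/
theorem exists_locallyConstantOn_selection {E : Type*} [PseudoMetricSpace E] {ι : Type*}
    {V : ι → Set E} (hV : ∀ i, IsOpen (V i)) (hcov : ∀ x, ∃ i, x ∈ V i) :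
    ∃ (idx : E → ι) (A : ℕ → Set E), (∀ x, x ∈ V (idx x)) ∧ (∀ n, IsClosed (A n)) ∧
      Monotone A ∧ (∀ x, ∃ n, x ∈ A n) ∧ ∀ n, IsLocallyConstantOn idx (A n) := by
  obtain ⟨_, _⟩ := exists_wellFoundedLT (α := ι)
  let idx : E → ι := fun x => wellFounded_lt.min {i | x ∈ V i} (hcov x)
  have hidx : ∀ x, x ∈ V (idx x) := fun x => wellFounded_lt.min_mem {i | x ∈ V i} (hcov x)
  have hmin : ∀ x i, x ∈ V i → idx x ≤ i := fun x i hi =>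
    not_lt.1 (wellFounded_lt.not_lt_min {i | x ∈ V i} hi)
  let δ : ℕ → ℝ := fun n => 1 / ((n : ℝ) + 1)
  have hδ : ∀ n, 0 < δ n := fun n => Nat.one_div_pos_of_nat
  -- Two such points closer than `δ n` lie in each other's chosen set, so their least indices
  -- coincide.
  let A : ℕ → Set E := fun n => {x | Metric.ball x (δ n) ⊆ V (idx x)}
  have hsep : ∀ n, ∀ x ∈ A n, ∀ y ∈ A n, dist x y < δ n → idx x = idx y := by
    intro n x hx y hy hxy
    apply le_antisymm
    · exact hmin x _ (hy (Metric.mem_ball.2 hxy))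
    · exact hmin y _ (hx (Metric.mem_ball'.2 hxy))
  refine ⟨idx, A, hidx, fun n => ?_, fun m n hmn x hx => ?_, fun x => ?_, fun n x hx => ?_⟩
  · rw [← closure_subset_iff_isClosed]
    intro x hx
    have hxi : ∀ y ∈ A n, dist x y < δ n → x ∈ V (idx y) := fun y hy hxy =>
      hy (Metric.mem_ball.2 hxy)
    -- A limit point inherits the common index of nearby points of `A n`: some of them lie in the
    -- open set `V (idx x)`, and `x` lies in their chosen sets.
    have hidxy : ∀ y ∈ A n, dist x y < δ n / 2 → idx y = idx x := by
      intro y hy hxy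
      apply le_antisymm
      · obtain ⟨ε, hε, hball⟩ := Metric.isOpen_iff.1 (hV (idx x)) x (hidx x)
        obtain ⟨z, hz, hxz⟩ := Metric.mem_closure_iff.1 hx (min ε (δ n / 2))
          (lt_min hε (half_pos (hδ n)))
        rw [lt_min_iff] at hxz
        have hzy : idx y = idx z := hsep n y hy z hz (by
          linarith [dist_triangle y x z, dist_comm x y])
        rw [hzy]
        exact hmin z _ (hball (Metric.mem_ball'.2 hxz.1))
      · exact hmin x _ (hxi y hy (by linarith [hδ n]))
    intro z hz
    rw [Metric.mem_ball] at hz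
    obtain ⟨y, hy, hxy⟩ := Metric.mem_closure_iff.1 hx
      (min (δ n / 2) (δ n - dist z x)) (lt_min (half_pos (hδ n)) (sub_pos.2 hz))
    rw [lt_min_iff] at hxy
    rw [← hidxy y hy hxy.1]
    apply hy
    rw [Metric.mem_ball]
    linarith [dist_triangle z x y]
  · exact (Metric.ball_subset_ball (Nat.one_div_le_one_div hmn)).trans hx
  · obtain ⟨ε, hε, h⟩ := Metric.isOpen_iff.1 (hV (idx x)) x (hidx x)
    obtain ⟨n, hn⟩ := exists_nat_one_div_lt hε
    exact ⟨n, (Metric.ball_subset_ball hn.le).trans h⟩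
  · have hb : ∀ᶠ y in 𝓝[A n] x, y ∈ Metric.ball x (δ n) :=
      mem_nhdsWithin_of_mem_nhds (Metric.ball_mem_nhds x (hδ n))
    filter_upwards [hb, self_mem_nhdsWithin] with y hy hyA
    exact hsep n y hyA x hx hy

theorem IsFSigmaSet.exists_monotone {X : Type u} [TopologicalSpace X] {A : Set X}
    (hA : IsFSigmaSet A) :
    ∃ F : ℕ → Set X, (∀ n, IsClosed (F n)) ∧ Monotone F ∧ ⋃ n, F n = A := by
  obtain ⟨F, hF, rfl⟩ := hA
  refine ⟨accumulate F, fun n => ?_, monotone_accumulate, iUnion_accumulate⟩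
  rw [accumulate_def]
  exact (finite_Iic n).isClosed_biUnion fun i _ => hF i

theorem IsGδ.isFSigmaSet_compl {X : Type u} [TopologicalSpace X] {A : Set X} (hA : IsGδ A) :
    IsFSigmaSet Aᶜ := by
  obtain ⟨U, hU, rfl⟩ := isGδ_iff_eq_iInter_nat.1 hA
  exact ⟨fun n => (U n)ᶜ, fun n => (hU n).isClosed_compl, compl_iInter U⟩

theorem exists_locallyConstantOn_approximation {X : Type*} [TopologicalSpace X] {Y : Type*}
    [PseudoMetricSpace Y] [LocallyPathConnectedSpace Y] {i : Y → X} (hi : IsEmbedding i)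
    {F C : ℕ → Set X} (hF : ∀ n, IsClosed (F n)) (hC : ∀ n, IsClosed (C n)) (hFm : Monotone F)
    (hCm : Monotone C) (hFi : ⋃ n, F n = range i) (hCi : ⋃ n, C n = (range i)ᶜ)
    {r : X → Y} {c : Y} (hr : ∀ y, r (i y) = y) (hrc : ∀ x, x ∉ range i → r x = c) {ε : ℝ}
    (hε : 0 < ε) {S : Set Y} (hS : ∀ y, ∃ s ∈ S, y ∈ pathComponentIn (Metric.ball s ε) s) :
    ∃ (p : X → Y) (A : ℕ → Set X), (∀ x, p x ∈ insert c S) ∧ (∀ n, IsClosed (A n)) ∧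
      Monotone A ∧ (∀ x, ∃ n, x ∈ A n) ∧ (∀ n, IsLocallyConstantOn p (A n)) ∧
      ∀ x, JoinedIn (Metric.ball (p x) ε) (p x) (r x) := by
  classical
  obtain ⟨idx, K, hidx, hK, hKm, hKcov, hKlc⟩ :=
    exists_locallyConstantOn_selection (ι := S)
      (V := fun s => pathComponentIn (Metric.ball (s : Y) ε) (s : Y))
      (fun s => Metric.isOpen_ball.pathComponentIn _)
      (fun y => let ⟨s, hs, hy⟩ := hS y; ⟨⟨s, hs⟩, hy⟩)
  let p : X → Y := fun x => if x ∈ range i then idx (r x) else c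
  have hpi : ∀ y, p (i y) = idx y := fun y => by
    simp only [p, mem_range_self, if_true, hr]
  have hpc : ∀ x, x ∉ range i → p x = c := fun x hx => if_neg hx
  have hFr : ∀ n, F n ⊆ range i := fun n => hFi ▸ subset_iUnion F n
  have hCr : ∀ n, C n ⊆ (range i)ᶜ := fun n => hCi ▸ subset_iUnion C n
  -- `K n` is closed only in `Y`; cutting with a closed subset of the range makes its image closed
  -- in `X`.
  have hKF : ∀ n, IsClosed (i '' K n ∩ F n) := by
    intro n
    obtain ⟨Z, hZ, hZK⟩ := hi.isInducing.isClosed_iff.1 (hK n)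
    have : i '' K n ∩ F n = Z ∩ F n := by
      rw [← hZK, image_preimage_eq_inter_range, inter_assoc, inter_eq_right.2 (hFr n)]
    rw [this]
    exact hZ.inter (hF n)
  refine ⟨p, fun n => i '' K n ∩ F n ∪ C n, fun x => ?_, fun n => (hKF n).union (hC n),
    fun m n hmn => union_subset_union (inter_subset_inter (image_mono (hKm hmn)) (hFm hmn))
      (hCm hmn), fun x => ?_, fun n => ?_, fun x => ?_⟩
  · by_cases hx : x ∈ range i
    · obtain ⟨y, rfl⟩ := hx
      rw [hpi]
      exact mem_insert_of_mem _ (idx y).2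
    · rw [hpc x hx]
      exact mem_insert _ _
  · by_cases hx : x ∈ range i
    · have hxF := hx
      rw [← hFi, mem_iUnion] at hxF
      obtain ⟨y, rfl⟩ := hx
      obtain ⟨m, hm⟩ := hKcov y
      obtain ⟨n, hn⟩ := hxF
      exact ⟨max m n, Or.inl ⟨mem_image_of_mem i (hKm (le_max_left m n) hm),
        hFm (le_max_right m n) hn⟩⟩
    · have hxC : x ∈ (range i)ᶜ := hx
      rw [← hCi, mem_iUnion] at hxC
      obtain ⟨n, hn⟩ := hxC
      exact ⟨n, Or.inr hn⟩
  · refine IsLocallyConstantOn.union (hKF n) (hC n) ?_ ?_ ?_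
    · exact disjoint_left.2 fun x hx hx' => hCr n hx' (hFr n hx.2)
    · refine IsLocallyConstantOn.mono ?_ inter_subset_left
      rintro _ ⟨y, hy, rfl⟩
      rw [← hi.map_nhdsWithin_eq, eventually_map]
      filter_upwards [hKlc n y hy] with z hz
      rw [hpi, hpi, hz]
    · intro x hx
      filter_upwards [self_mem_nhdsWithin] with y hy
      rw [hpc x (hCr n hx), hpc y (hCr n hy)]
  · by_cases hx : x ∈ range i
    · obtain ⟨y, rfl⟩ := hx
      rw [hpi, hr]
      exact hidx y
    · rw [hpc x hx, hrc x hx]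
      exact JoinedIn.refl (Metric.mem_ball_self hε)

theorem isBaireOne_of_isEmbedding_of_isAmbiguousSet {X Y : Type u} [TopologicalSpace X]
    [NormalSpace X] [PseudoMetricSpace Y] [PathConnectedSpace Y] [LocallyPathConnectedSpace Y]
    (h : TopologicalSpace.SeparableSpace Y ∨ IsCollectionwiseNormal X)
    {i : Y → X} (hi : IsEmbedding i) (hamb : IsAmbiguousSet (range i)) {r : X → Y} {c : Y}
    (hr : ∀ y, r (i y) = y) (hrc : ∀ x, x ∉ range i → r x = c) : IsBaireOne r := by
  obtain ⟨F, hF, hFm, hFi⟩ := hamb.1.exists_monotone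
  obtain ⟨C, hC, hCm, hCi⟩ := hamb.2.isFSigmaSet_compl.exists_monotone
  have hS : ∀ k : ℕ, ∃ S : Set Y, (S.Countable ∨ IsCollectionwiseNormal X) ∧
      ∀ y, ∃ s ∈ S, y ∈ pathComponentIn (Metric.ball s ((1 / 2 : ℝ) ^ k)) s := by
    intro k
    have hk : (0 : ℝ) < (1 / 2) ^ k := by positivity
    rcases h with h | h
    -- Separability leaves countably many centres, hence countably many values.
    · have := UniformSpace.secondCountable_of_separable Y
      obtain ⟨S, hS, hcov⟩ := TopologicalSpace.countable_cover_nhds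
        (f := fun s : Y => pathComponentIn (Metric.ball s ((1 / 2 : ℝ) ^ k)) s)
        fun s => pathComponentIn_mem_nhds (Metric.ball_mem_nhds s hk)
      refine ⟨S, Or.inl hS, fun y => ?_⟩
      have hy := hcov.symm ▸ mem_univ y
      simpa only [mem_iUnion, exists_prop] using hy
    · exact ⟨univ, Or.inr h, fun y => ⟨y, mem_univ y,
        mem_pathComponentIn_self (Metric.mem_ball_self hk)⟩⟩
  choose S hSc hScov using hS
  choose p A hpS hA hAm hAcov hpA hpr using fun k =>
    exists_locallyConstantOn_approximation hi hF hC hFm hCm hFi hCi hr hrc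
      (show (0 : ℝ) < (1 / 2) ^ k by positivity) (hScov k)
  -- Stage 0 is made constant so that the corrections start from a continuous map.
  let p' : ℕ → X → Y := fun k => if k = 0 then fun _ => c else p k
  have hp' : ∀ k, k ≠ 0 → p' k = p k := fun k hk => if_neg hk
  have hp'S : ∀ k x, p' k x ∈ insert c (S k) := by
    intro k x
    rcases eq_or_ne k 0 with rfl | hk
    · exact mem_insert _ _
    · rw [hp' k hk]
      exact hpS k x
  refine isBaireOne_of_locallyConstant_approximation p' A c (fun _ => rfl) hA hAm hAcov ?_ ?_ ?_
  · intro k n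
    rcases eq_or_ne k 0 with rfl | hk
    · exact fun x _ => Eventually.of_forall fun y => rfl
    · rw [hp' k hk]
      exact hpA k n
  · intro k B hB hlc
    rcases hSc k with h₁ | h₁
    · rcases hSc (k + 1) with h₂ | h₂
      · exact hlc.hasDiscreteExpansion_of_countable ((h₁.insert c).prod (h₂.insert c))
          (fun x => ⟨hp'S k x, hp'S (k + 1) x⟩) hB
      · exact hlc.hasDiscreteExpansion_of_collectionwiseNormal h₂ hB
    · exact hlc.hasDiscreteExpansion_of_collectionwiseNormal h₁ hB
  · intro k x hk
    rw [hp' k hk]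
    exact hpr k x

theorem theorem3p3 {X : Type u} [TopologicalSpace X] [NormalSpace X] (E : Set X)
    (hE : IsAmbiguousSet E) [TopologicalSpace.MetrizableSpace E]
    [PathConnectedSpace E] [LocallyPathConnectedSpace E]
    (h : TopologicalSpace.SeparableSpace E ∨ IsCollectionwiseNormal X) :
    IsB1Retract E ∧ ∀ c : E, IsB1Retraction E (collapseTo E c) := by
  have key : ∀ c : E, IsB1Retraction E (collapseTo E c) := by
    intro c
    let _ := TopologicalSpace.metrizableSpaceMetric E
    have hid : ∀ x : E, collapseTo E c x = x := fun x => dif_pos x.2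
    refine ⟨isBaireOne_of_isEmbedding_of_isAmbiguousSet (c := c) h (IsEmbedding.subtypeVal) ?_
      hid ?_, hid⟩
    · rwa [Subtype.range_coe]
    · rw [Subtype.range_coe]
      exact fun x hx => dif_neg hx
  obtain ⟨c⟩ : Nonempty E := inferInstance
  exact ⟨⟨_, key c⟩, key⟩
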